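/- Let $m\ge 1$ and $n\ge 0$ be integers. An $m$-ballot path of size $n$ is a lattice path from $(0,0)$ to $(mn,n)$ with up steps $1=(0,1)$ and down steps $0=(1,0)$ all of whose points $(x,y)$ satisfy $x\le my$. It is primitive if it is nonempty and meets the line $x=my$ only at its two ends. A rotation of a path exchanges a down step that is followed by a (translated) primitive path $c$ with $c$. The $m$-Tamari lattice $\mathcal{T}_n^{(m)}$ is the set of $m$-ballot paths of size $n$, ordered by $D\le D'$ if $D'$ is obtained from $D$ by a (possibly empty) sequence of rotations. The number of returns to $0$ of a path is its number of contacts with the line $x=my$ after the origin. An $(m+1)$-ary tree is either empty or a root node with $m+1$ ordered subtrees $T_L,T_{R_1},\dots,T_{R_m}$. The path $D(T)$ of a tree is defined by letting $D(\emptyset)$ be the empty path and $D(T)=D(T_L)\,1\,D(T_{R_m})\,0\,D(T_{R_{m-1}})\,0\cdots D(T_{R_1})\,0$; an $(m+1)$-ary tree with $n$ nodes is thereby identified with an $m$-ballot path of size $n$, and $T'\le T$ means $D(T')\le D(T)$ in $\mathcal{T}_n^{(m)}$. The left branch of a nonempty tree consists of its root and the left branch of $T_L$ (the left branch of the empty tree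 is empty). For polynomials in $x,y$ put $\Delta(g)=\dfrac{x\,g(x,y)-g(1,y)}{x-1}$ and $$B^{(m)}(f,g_1,\dots,g_m)=f\,x\,y\,\Delta(g_1\Delta(g_2\Delta(\cdots\Delta(g_m))\cdots)).$$ For an $(m+1)$-ary tree $T$ define $\mathcal{B}_T^{(m)}\in\mathbb{Z}[x]$ recursively by $\mathcal{B}_\emptyset^{(m)}=1$ and, for nonempty $T$, $$\mathcal{B}_T^{(m)}=B^{(m)}\bigl(\mathcal{B}_{T_L}^{(m)},\mathcal{B}_{T_{R_1}}^{(m)},\dots,\mathcal{B}_{T_{R_m}}^{(m)}\bigr)\Big|_{y=1}.$$ **Theorem.** Let $T$ be an $(m+1)$-ary tree with $n$ nodes. Then $\mathcal{B}_T^{(m)}$ counts the elements of $\mathcal{T}_n^{(m)}$ that are smaller than or equal to $T$ according to the number of nodes on their left branch or, equivalently, according to the number of returns to $0$ of their paths: $$\mathcal{B}_T^{(m)}(x)=\sum_{T'\le T}x^{\,\#\{\text{nodes on the left branch of }T'\}}=\sum_{D\le D(T)}x^{\,\#\{\text{returns to }0\text{ of }D\}},$$ where $T'$ runs over the $(m+1)$-ary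 trees with $n$ nodes and $D$ over the $m$-ballot paths of size $n$, and for every $(m+1)$-ary tree $T'$ with $n$ nodes the number of nodes on its left branch equals the number of returns to $0$ of $D(T')$. In particular, $\mathcal{B}_T^{(m)}(1)$ is the number of elements smaller than or equal to $T$. -/

import Mathlib

open Polynomial

namespace MTamari

/-! ## `m`-ballot paths and the `m`-Tamari order

A path is a word on `Bool`: `true` is the vertical (up) step `(0, 1)` and `false` is the horizontal
(down) step `(1, 0)`. -/

/-- `w` is an `m`-ballot path of size `n`: it goes from `(0, 0)` to `(m n, n)` and every point
`(x, y)` on it satisfies `x ≤ m y`. -/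
def IsBallot (m n : ℕ) (w : List Bool) : Prop :=
  w.count true = n ∧ w.count false = m * n ∧
    ∀ p, p <+: w → p.count false ≤ m * p.count true

/-- A nonempty ballot path which meets the line `x = m y` only at its two ends. -/
def IsPrimitive (m : ℕ) (c : List Bool) : Prop :=
  (∃ k, IsBallot m k c) ∧ c ≠ [] ∧
    ∀ p, p <+: c → p ≠ [] → p ≠ c → p.count false ≠ m * p.count true

/-- The `m`-ballot paths of size `n`. -/
def BallotPath (m n : ℕ) : Type := {w : List Bool // IsBallot m n w}

/-- `v` is obtained from `u` by a rotation: a down step of `u` which is followed by a primitive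
path `c` is exchanged with `c`. -/
def Rotation {m n : ℕ} (u v : BallotPath m n) : Prop :=
  ∃ a c b : List Bool, IsPrimitive m c ∧
    u.1 = a ++ false :: (c ++ b) ∧ v.1 = a ++ (c ++ false :: b)

/-- The number of returns to `0`: contacts with the line `x = m y` after the origin. -/
def BallotPath.returns {m n : ℕ} (D : BallotPath m n) : ℕ :=
  ((Finset.Icc 1 D.1.length).filter fun k =>
    (D.1.take k).count false = m * (D.1.take k).count true).card

theorem Rotation.lt {m n : ℕ} {u v : BallotPath m n} (h : Rotation u v) : u.1 < v.1 := by
  obtain ⟨a, c, b, ⟨⟨k, hk⟩, hc, -⟩, hu, hv⟩ := h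
  rw [hu, hv]
  apply List.append_left_lt
  cases c with
  | nil => exact absurd rfl hc
  | cons x c =>
    cases x with
    | true => exact List.Lex.rel (by decide)
    | false =>
      have := hk.2.2 [false] (by simp)
      simp at this

/-- The `m`-Tamari order: `u ≤ v` if `v` is reached from `u` by a sequence of rotations. -/
instance (m n : ℕ) : PartialOrder (BallotPath m n) where
  le := Relation.ReflTransGen Rotation
  le_refl _ := Relation.ReflTransGen.refl
  le_trans _ _ _ := Relation.ReflTransGen.trans
  le_antisymm u v huv hvu := by
    have key : ∀ {a b : BallotPath m n}, Relation.ReflTransGen Rotation a b → a.1 ≤ b.1 := by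
      intro a b h
      induction h with
      | refl => exact le_rfl
      | tail _ h ih => exact ih.trans h.lt.le
    exact Subtype.ext (le_antisymm (key huv) (key hvu))

/-! ## `(m+1)`-ary trees -/

/-- `(m+1)`-ary trees: the empty tree, or a root with `m + 1` ordered subtrees, the leftmost one
`T_L` having index `0` and the others `T_{R_1}, …, T_{R_m}` having indices `1, …, m`. -/
inductive Tree (m : ℕ) : Type
  | empty : Tree m
  | node : (Fin (m + 1) → Tree m) → Tree m

/-- The number of nodes. -/
def Tree.size {m : ℕ} : Tree m → ℕ
  | .empty => 0
  | .node f => 1 + ∑ i, (f i).size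

/-- The number of nodes on the left branch. -/
def Tree.leftBranch {m : ℕ} : Tree m → ℕ
  | .empty => 0
  | .node f => 1 + (f 0).leftBranch

/-- The word of the path of a tree: `D = D_L 1 D_{R_m} 0 D_{R_{m-1}} 0 … D_{R_1} 0`. -/
def Tree.word {m : ℕ} : Tree m → List Bool
  | .empty => []
  | .node f => (f 0).word ++
      true :: (List.ofFn fun i : Fin m => (f i.succ).word ++ [false]).reverse.flatten

theorem count_blocks {m : ℕ} (L : List (List Bool))
    (h : ∀ w ∈ L, w.count false = m * w.count true) :
    (L.map (· ++ [false])).flatten.count false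
      = m * (L.map (· ++ [false])).flatten.count true + L.length := by
  induction L with
  | nil => simp
  | cons w L ih =>
    have h1 := ih fun w hw => h w (by simp [hw])
    have h2 := h w (by simp)
    simp only [List.map_cons, List.flatten_cons, List.count_append, List.length_cons, h1, h2]
    simp
    ring

theorem prefix_blocks {m : ℕ} (L : List (List Bool))
    (h : ∀ w ∈ L, w.count false = m * w.count true ∧
      ∀ p, p <+: w → p.count false ≤ m * p.count true)
    (p : List Bool) (hp : p <+: (L.map (· ++ [false])).flatten)
    (hne : p ≠ (L.map (· ++ [false])).flatten) :
    p.count false < m * p.count true + L.length := by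
  induction L generalizing p with
  | nil => simp at hp hne; exact absurd hp hne
  | cons w L ih =>
    have h2 := h w (by simp)
    simp only [List.map_cons, List.flatten_cons, List.append_assoc, List.singleton_append] at hp hne
    rcases List.prefix_or_prefix_of_prefix hp (List.prefix_append w _) with hw | ⟨q, rfl⟩
    · have := h2.2 p hw
      simp; omega
    · rw [List.prefix_append_right_inj] at hp
      cases q with
      | nil => simp; omega
      | cons x q =>
        rw [List.cons_prefix_cons] at hp
        obtain ⟨rfl, hq⟩ := hp
        have := ih (fun w hw => h w (by simp [hw])) q hq (by rintro rfl; exact hne rfl)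
        simp [mul_add]; omega

theorem blocks_injective {m : ℕ} (L L' : List (List Bool)) (hl : L.length = L'.length)
    (h : ∀ w ∈ L, w.count false = m * w.count true ∧
      ∀ p, p <+: w → p.count false ≤ m * p.count true)
    (h' : ∀ w ∈ L', w.count false = m * w.count true ∧
      ∀ p, p <+: w → p.count false ≤ m * p.count true)
    (e : (L.map (· ++ [false])).flatten = (L'.map (· ++ [false])).flatten) : L = L' := by
  have key : ∀ (w v s t : List Bool), w.count false = m * w.count true →
      (∀ p, p <+: v → p.count false ≤ m * p.count true) →
      w ++ false :: s = v ++ false :: t → v <+: w := by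
    intro w v s t hw hv e
    rcases List.prefix_or_prefix_of_prefix (List.prefix_append w (false :: s))
      (e ▸ List.prefix_append v (false :: t)) with ⟨q, rfl⟩ | hh
    · cases q with
      | nil => simp
      | cons x q =>
        simp only [List.append_assoc, List.append_cancel_left_eq, List.cons_append,
          List.cons.injEq] at e
        obtain ⟨rfl, -⟩ := e
        have := hv (w ++ [false]) ⟨q, by simp⟩
        simp at this; omega
    · exact hh
  induction L generalizing L' with
  | nil => cases L' with
    | nil => rfl
    | cons => simp at hl
  | cons w L ih => cases L' with
    | nil => simp at hl
    | cons v L' =>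
      have hw := h w (by simp)
      have hv := h' v (by simp)
      simp only [List.map_cons, List.flatten_cons, List.append_assoc, List.singleton_append] at e
      have : w = v := by
        have h1 := key w v _ _ hw.1 hv.2 e
        have h2 := key v w _ _ hv.1 hw.2 e.symm
        exact h2.eq_of_length_le h1.length_le
      subst this
      simp only [List.append_cancel_left_eq, List.cons.injEq, true_and] at e
      rw [ih L' (by simpa using hl) (fun w hw => h w (by simp [hw]))
        (fun w hw => h' w (by simp [hw])) e]

/-- The words of the right subtrees, from the last one to the first one. -/
def Tree.rights {m : ℕ} (f : Fin (m + 1) → Tree m) : List (List Bool) :=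
  (List.ofFn fun i : Fin m => (f i.succ).word).reverse

theorem Tree.word_node {m : ℕ} (f : Fin (m + 1) → Tree m) :
    (Tree.node f).word =
      (f 0).word ++ true :: ((Tree.rights f).map (· ++ [false])).flatten := by
  rw [Tree.word, Tree.rights, List.map_reverse, List.map_ofFn]; rfl

theorem Tree.word_count_true {m : ℕ} (T : Tree m) : T.word.count true = T.size := by
  induction T with
  | empty => rfl
  | node f ih =>
    rw [Tree.word, Tree.size, Fin.sum_univ_succ]
    simp only [List.count_append, List.count_cons, List.count_flatten, List.map_reverse,
      List.sum_reverse, List.map_ofFn, List.sum_ofFn, ih]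
    simp [ih]; ring

theorem Tree.word_balanced {m : ℕ} (T : Tree m) :
    T.word.count false = m * T.word.count true ∧
      ∀ p, p <+: T.word → p.count false ≤ m * p.count true := by
  induction T with
  | empty => simp [Tree.word]
  | node f ih =>
    have hr : ∀ w ∈ Tree.rights f, w.count false = m * w.count true ∧
        ∀ p, p <+: w → p.count false ≤ m * p.count true := by
      intro w hw
      simp only [Tree.rights, List.mem_reverse, List.mem_ofFn] at hw
      obtain ⟨i, rfl⟩ := hw
      exact ih _
    have hlen : (Tree.rights f).length = m := by simp [Tree.rights]
    have hc := count_blocks _ fun w hw => (hr w hw).1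
    have h0 := ih 0
    rw [Tree.word_node]
    refine ⟨?_, fun p hp => ?_⟩
    · simp only [List.count_append, List.count_cons, h0.1, hc, hlen]
      simp; ring
    · rcases List.prefix_or_prefix_of_prefix hp (List.prefix_append (f 0).word _) with hw | ⟨q, rfl⟩
      · exact h0.2 p hw
      · rw [List.prefix_append_right_inj] at hp
        cases q with
        | nil => simp [h0.1]
        | cons x q =>
          rw [List.cons_prefix_cons] at hp
          obtain ⟨rfl, hq⟩ := hp
          have : q.count false ≤ m * q.count true + m := by
            by_cases hne : q = ((Tree.rights f).map (· ++ [false])).flatten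
            · rw [hne, hc, hlen]
            · have := prefix_blocks _ hr q hq hne
              omega
          simp [mul_add, h0.1]; omega

theorem Tree.word_injective {m : ℕ} : Function.Injective (Tree.word (m := m)) := by
  have key : ∀ f g : Fin (m + 1) → Tree m, (Tree.node f).word = (Tree.node g).word →
      (g 0).word <+: (f 0).word := by
    intro f g e
    rw [Tree.word_node, Tree.word_node] at e
    rcases List.prefix_or_prefix_of_prefix (List.prefix_append (f 0).word _)
      (e ▸ List.prefix_append (g 0).word _) with ⟨q, hq⟩ | hh
    · cases q with
      | nil => simp [← hq]
      | cons x q =>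
        rw [← hq] at e
        simp only [List.append_assoc, List.append_cancel_left_eq, List.cons_append,
          List.cons.injEq] at e
        obtain ⟨rfl, e⟩ := e
        have h1 := prefix_blocks (m := m) (Tree.rights f) (by
          intro w hw
          simp only [Tree.rights, List.mem_reverse, List.mem_ofFn] at hw
          obtain ⟨i, rfl⟩ := hw
          exact Tree.word_balanced _) q ⟨_, e.symm⟩ (by intro h; rw [h] at e; simp at e)
        have h2 := (Tree.word_balanced (g 0)).1
        have h3 := (Tree.word_balanced (f 0)).1
        have hlen : (Tree.rights f).length = m := by simp [Tree.rights]
        rw [← hq] at h2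
        simp [mul_add] at h2
        omega
    · exact hh
  intro S T e
  induction S generalizing T with
  | empty => cases T with
    | empty => rfl
    | node g => simp [Tree.word] at e
  | node f ih => cases T with
    | empty => simp [Tree.word] at e
    | node g =>
      have h0 : (f 0).word = (g 0).word :=
        (key g f e.symm).eq_of_length_le (key f g e).length_le
      rw [Tree.word_node, Tree.word_node, h0] at e
      simp only [List.append_cancel_left_eq, List.cons.injEq, true_and] at e
      have hr : ∀ f : Fin (m + 1) → Tree m, ∀ w ∈ Tree.rights f,
          w.count false = m * w.count true ∧
            ∀ p, p <+: w → p.count false ≤ m * p.count true := by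
        intro f w hw
        simp only [Tree.rights, List.mem_reverse, List.mem_ofFn] at hw
        obtain ⟨i, rfl⟩ := hw
        exact Tree.word_balanced _
      have := blocks_injective _ _ (by simp [Tree.rights]) (hr f) (hr g) e
      rw [Tree.rights, Tree.rights, List.reverse_inj, List.ofFn_inj] at this
      congr 1
      funext i
      refine Fin.cases ?_ (fun i => ?_) i
      · exact ih 0 h0
      · exact ih i.succ (congrFun this i)

/-- The `(m+1)`-ary trees with `n` nodes. -/
def SizedTree (m n : ℕ) : Type := {T : Tree m // T.size = n}

/-- The `m`-ballot path of size `n` corresponding to an `(m+1)`-ary tree with `n` nodes. -/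
def SizedTree.toPath {m n : ℕ} (T : SizedTree m n) : BallotPath m n :=
  ⟨T.1.word, by
    have h := T.1.word_balanced
    rw [T.1.word_count_true, T.2] at h
    exact ⟨T.1.word_count_true.trans T.2, h.1, h.2⟩⟩

theorem SizedTree.toPath_injective {m n : ℕ} :
    Function.Injective (SizedTree.toPath (m := m) (n := n)) := fun _ _ h =>
  Subtype.ext (Tree.word_injective (congrArg Subtype.val h))

/-- The `m`-Tamari order on `(m+1)`-ary trees, carried over from paths. -/
instance (m n : ℕ) : PartialOrder (SizedTree m n) :=
  PartialOrder.lift SizedTree.toPath SizedTree.toPath_injective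

instance (m n : ℕ) : Finite (BallotPath m n) := by
  have h : Set.Finite {w : List Bool | IsBallot m n w} := by
    refine (List.finite_length_eq Bool (n + m * n)).subset fun w hw => ?_
    have := List.count_true_add_count_false w
    have h1 := hw.1
    have h2 := hw.2.1
    change w.length = n + m * n; omega
  exact h.to_subtype

instance (m n : ℕ) : Finite (SizedTree m n) :=
  Finite.of_injective _ SizedTree.toPath_injective

noncomputable instance (m n : ℕ) : Fintype (BallotPath m n) := Fintype.ofFinite _

noncomputable instance (m n : ℕ) : Fintype (SizedTree m n) := Fintype.ofFinite _

noncomputable instance (m n : ℕ) : DecidableLE (BallotPath m n) := Classical.decRel _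

noncomputable instance (m n : ℕ) : DecidableLE (SizedTree m n) := Classical.decRel _

/-! ## The polynomials

A polynomial in `x, y` is an element of `ℤ[X][X]`, where the outer variable is `x` and the inner
one is `y`. -/

/-- The divided difference `Δ(g) = (x g(x, y) - g(1, y)) / (x - 1)`. -/
noncomputable def Δ (g : ℤ[X][X]) : ℤ[X][X] := (X * g - C (g.eval 1)) /ₘ (X - C 1)

/-- The division in `Δ` is exact. -/
theorem Δ_spec (g : ℤ[X][X]) : (X - 1) * Δ g = X * g - C (g.eval 1) := by
  have := (Polynomial.mul_divByMonic_eq_iff_isRoot (a := (1 : ℤ[X]))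
    (p := X * g - C (g.eval 1))).2 (by simp [IsRoot])
  simpa [Δ] using this

/-- `B^{(m)}(f, g_1, …, g_m) = f x y Δ(g_1 Δ(g_2 Δ(⋯ Δ(g_m))⋯))`. -/
noncomputable def B {m : ℕ} (f : ℤ[X][X]) (g : Fin m → ℤ[X][X]) : ℤ[X][X] :=
  f * X * C X * (List.ofFn g).foldr (fun h acc => Δ (h * acc)) 1

/-- A polynomial in `x` as a polynomial in `x, y`. -/
noncomputable def toXY : ℤ[X] →+* ℤ[X][X] := mapRingHom C

/-- The substitution `y = 1`. -/
noncomputable def atYOne : ℤ[X][X] →+* ℤ[X] := mapRingHom (evalRingHom 1)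

/-- The polynomial `𝓑_T^{(m)}(x)`: it is `1` for the empty tree, and
`B^{(m)}(𝓑_{T_L}, 𝓑_{T_{R_1}}, …, 𝓑_{T_{R_m}})` at `y = 1` otherwise. -/
noncomputable def Tree.poly {m : ℕ} : Tree m → ℤ[X]
  | .empty => 1
  | .node f => atYOne (B (toXY (f 0).poly) fun i : Fin m => toXY (f i.succ).poly)

end MTamari

/-! The word of a tree is built from the words of its subtrees by three operations: appending a
ballot word, prepending an up step and appending a down step. The proof follows the lower set of a
word through each of them. Since the intermediate words are not ballot paths, it works with all
words that end at their lowest level (`Descends`), and it replaces returns by nonempty ballot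
suffixes (`suffixCount`), which make sense for such words.

A rotation never straddles the start of a ballot suffix, so the lower set of `u ++ v` is a product
(`wordLe_append_iff`); an initial up step never moves (`wordLe_true_iff`). The heart is
`wordLe_append_false_iff`: the words below `u0` arise from the words below `u` by inserting a down
step just before a ballot suffix, possibly empty. Only the ballot suffixes after the insertion
survive, so a word with `r` of them contributes `1 + x + ⋯ + x^r = (x^{r+1} - 1)/(x - 1) = Δ(x^r)`.
The generating polynomial thus obeys the recursion of `Tree.poly` at `y = 1`. To sum over trees
instead of paths, `Descends.exists_tree` shows that every ballot path comes from a tree. -/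

namespace MTamari

/-! ## Levels of words -/

/-- The level reached by a word: an up step counts for `m`, a down step for `-1`. -/
def lev (m : ℕ) (w : List Bool) : ℤ := m * w.count true - w.count false

@[simp] theorem lev_nil (m : ℕ) : lev m [] = 0 := by simp [lev]

@[simp] theorem lev_append (m : ℕ) (u v : List Bool) : lev m (u ++ v) = lev m u + lev m v := by
  simp [lev]; ring

@[simp] theorem lev_true (m : ℕ) (w : List Bool) : lev m (true :: w) = m + lev m w := by
  simp [lev]; ring

@[simp] theorem lev_false (m : ℕ) (w : List Bool) : lev m (false :: w) = -1 + lev m w := by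
  simp [lev]; ring

/-- All points of the word `w` have level at least `k`. -/
def Above (m : ℕ) (k : ℤ) (w : List Bool) : Prop := ∀ p, p <+: w → k ≤ lev m p

@[simp] theorem above_nil {m : ℕ} {k : ℤ} : Above m k [] ↔ k ≤ 0 := by
  simp [Above]

@[simp] theorem above_append {m : ℕ} {k : ℤ} {u v : List Bool} :
    Above m k (u ++ v) ↔ Above m k u ∧ Above m (k - lev m u) v := by
  refine ⟨fun h => ⟨fun p hp => h p (hp.trans (List.prefix_append _ _)), fun p hp => ?_⟩,
    fun ⟨h, h'⟩ p hp => ?_⟩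
  · have := h (u ++ p) ((List.prefix_append_right_inj u).2 hp)
    rw [lev_append] at this; omega
  · rcases List.prefix_or_prefix_of_prefix hp (List.prefix_append u v) with hw | ⟨q, rfl⟩
    · exact h p hw
    · have := h' q ((List.prefix_append_right_inj u).1 hp)
      rw [lev_append]; omega

theorem above_cons {m : ℕ} {k : ℤ} {a : Bool} {w : List Bool} :
    Above m k (a :: w) ↔ k ≤ 0 ∧ Above m (k - lev m [a]) w := by
  refine ⟨fun h => ⟨by simpa using h [] (by simp), fun p hp => ?_⟩, fun ⟨h, h'⟩ p hp => ?_⟩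
  · have := h (a :: p) (by simpa using hp)
    rw [← List.singleton_append, lev_append] at this; omega
  · cases p with
    | nil => simpa using h
    | cons b p =>
      rw [List.cons_prefix_cons] at hp
      obtain ⟨rfl, hp⟩ := hp
      have := h' p hp
      rw [← List.singleton_append, lev_append]; omega

@[simp] theorem above_true {m : ℕ} {k : ℤ} {w : List Bool} :
    Above m k (true :: w) ↔ k ≤ 0 ∧ Above m (k - m) w := by
  simp [above_cons]

@[simp] theorem above_false {m : ℕ} {k : ℤ} {w : List Bool} :
    Above m k (false :: w) ↔ k ≤ 0 ∧ Above m (k + 1) w := by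
  simp [above_cons]

theorem Above.mono {m : ℕ} {k l : ℤ} {w : List Bool} (h : Above m l w) (hk : k ≤ l) :
    Above m k w := fun p hp => hk.trans (h p hp)

theorem Above.le_lev {m : ℕ} {k : ℤ} {w : List Bool} (h : Above m k w) : k ≤ lev m w :=
  h w (List.prefix_refl w)

theorem Above.nonpos {m : ℕ} {k : ℤ} {w : List Bool} (h : Above m k w) : k ≤ 0 := by
  simpa using h [] (by simp)

/-- The word `w` ends at level `k` and stays at level at least `k`. -/
def Descends (m : ℕ) (k : ℤ) (w : List Bool) : Prop := lev m w = k ∧ Above m k w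

theorem isBallot_iff {m n : ℕ} {w : List Bool} :
    IsBallot m n w ↔ w.count true = n ∧ Descends m 0 w := by
  have h (p : List Bool) : 0 ≤ lev m p ↔ p.count false ≤ m * p.count true := by
    simp only [lev]; zify; omega
  simp only [IsBallot, Descends, Above, h]
  refine and_congr_right fun hn => and_congr_left fun _ => ?_
  rw [← hn, lev]; zify; omega

theorem Descends.of_append_right {m : ℕ} {k : ℤ} {u v : List Bool} (h : Descends m k (u ++ v))
    (hv : Descends m 0 v) : Descends m k u := by
  have h1 := h.1
  rw [lev_append, hv.1] at h1
  exact ⟨by omega, (above_append.1 h.2).1⟩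

theorem Descends.append {m : ℕ} {k : ℤ} {u v : List Bool} (hu : Descends m k u)
    (hv : Descends m 0 v) : Descends m k (u ++ v) :=
  ⟨by rw [lev_append, hu.1, hv.1, add_zero], above_append.2 ⟨hu.2, by simpa [hu.1] using hv.2⟩⟩

theorem descends_nil {m : ℕ} : Descends m 0 [] := by simp [Descends]

theorem descends_true {m : ℕ} {w : List Bool} :
    Descends m 0 (true :: w) ↔ Descends m (-m) w := by
  simp only [Descends, lev_true, above_true, le_refl, true_and, zero_sub]
  exact and_congr_left fun _ => by omega

theorem Descends.append_false {m : ℕ} {k : ℤ} {u : List Bool} (h : Descends m k u) :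
    Descends m (k - 1) (u ++ [false]) := by
  refine ⟨by rw [lev_append, h.1]; simp; omega, ?_⟩
  simp only [above_append, above_false, above_nil, h.1]
  exact ⟨h.2.mono (by omega), by omega, by omega⟩

namespace IsPrimitive

variable {m : ℕ} {c : List Bool}

theorem descends (h : IsPrimitive m c) : Descends m 0 c := by
  obtain ⟨⟨k, hk⟩, -⟩ := h
  exact (isBallot_iff.1 hk).2

theorem lev_pos {d e : List Bool} (h : IsPrimitive m (d ++ e)) (hd : d ≠ []) (he : e ≠ []) :
    0 < lev m d := by
  have h1 := (above_append.1 h.descends.2).1.le_lev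
  have h2 := h.2.2 d (List.prefix_append d e) hd (by simpa using he)
  refine lt_of_le_of_ne h1 fun h3 => h2 ?_
  simp only [lev] at h3
  zify; omega

theorem head_ne_false {d : List Bool} (h : IsPrimitive m (false :: d)) : False := by
  have := (above_false.1 h.descends.2).2.nonpos
  omega

end IsPrimitive

/-! ## Rotations of words -/

/-- The word `v` is obtained from `u` by a rotation. -/
def WordRot (m : ℕ) (u v : List Bool) : Prop :=
  ∃ a c b : List Bool, IsPrimitive m c ∧ u = a ++ false :: (c ++ b) ∧ v = a ++ (c ++ false :: b)

/-- The word `v` is obtained from `u` by a sequence of rotations. -/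
def WordLe (m : ℕ) : List Bool → List Bool → Prop := Relation.ReflTransGen (WordRot m)

theorem WordRot.append_left {m : ℕ} {u v : List Bool} (h : WordRot m u v) (w : List Bool) :
    WordRot m (w ++ u) (w ++ v) := by
  obtain ⟨a, c, b, hc, rfl, rfl⟩ := h
  exact ⟨w ++ a, c, b, hc, by simp, by simp⟩

theorem WordRot.append_right {m : ℕ} {u v : List Bool} (h : WordRot m u v) (w : List Bool) :
    WordRot m (u ++ w) (v ++ w) := by
  obtain ⟨a, c, b, hc, rfl, rfl⟩ := h
  exact ⟨a, c, b ++ w, hc, by simp, by simp⟩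

theorem WordLe.append_left {m : ℕ} {u v : List Bool} (h : WordLe m u v) (w : List Bool) :
    WordLe m (w ++ u) (w ++ v) :=
  Relation.ReflTransGen.lift (w ++ ·) (fun _ _ h => h.append_left w) _ _ h

theorem WordLe.append_right {m : ℕ} {u v : List Bool} (h : WordLe m u v) (w : List Bool) :
    WordLe m (u ++ w) (v ++ w) :=
  Relation.ReflTransGen.lift (· ++ w) (fun _ _ h => h.append_right w) _ _ h

theorem WordLe.append {m : ℕ} {u u' v v' : List Bool} (h : WordLe m u u') (h' : WordLe m v v') :
    WordLe m (u ++ v) (u' ++ v') := (h.append_right v).trans (h'.append_left u')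

theorem WordRot.perm {m : ℕ} {u v : List Bool} (h : WordRot m u v) : u.Perm v := by
  obtain ⟨a, c, b, -, rfl, rfl⟩ := h
  exact List.Perm.append_left a (List.perm_middle.symm)

theorem WordLe.perm {m : ℕ} {u v : List Bool} (h : WordLe m u v) : u.Perm v := by
  induction h with
  | refl => exact List.Perm.refl _
  | tail _ h ih => exact ih.trans h.perm

theorem WordRot.lev_eq {m : ℕ} {u v : List Bool} (h : WordRot m u v) : lev m u = lev m v := by
  simp only [lev, h.perm.count_eq]

/-- Delaying the down step lifts the points of `c` by one and changes no level elsewhere. -/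
theorem WordRot.descends {m : ℕ} {k : ℤ} {u v : List Bool} (h : WordRot m u v)
    (hu : Descends m k u) : Descends m k v := by
  refine ⟨h.lev_eq ▸ hu.1, ?_⟩
  obtain ⟨a, c, b, hc, rfl, rfl⟩ := h
  have h1 := hu.2
  have h2 := hc.descends.1
  simp only [above_append, above_false, h2] at h1 ⊢
  obtain ⟨h3, h4, h5, h6⟩ := h1
  exact ⟨h3, h5.mono (by omega), by omega, h6.mono (by omega)⟩

/-- Rotations of plain words starting from a ballot path stay among ballot paths, so the order may
be studied on words. -/
theorem le_iff_wordLe {m n : ℕ} {D E : BallotPath m n} : D ≤ E ↔ WordLe m D.1 E.1 := by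
  constructor
  · intro h
    exact Relation.ReflTransGen.lift Subtype.val (fun _ _ h => h) _ _ h
  · obtain ⟨u, hu⟩ := D
    obtain ⟨v, hv⟩ := E
    intro h
    change WordLe m u v at h
    induction h using Relation.ReflTransGen.head_induction_on with
    | refl => exact le_rfl
    | @head u w h _ ih =>
      have hw : IsBallot m n w := by
        rw [isBallot_iff] at hu ⊢
        exact ⟨h.perm.count_eq true ▸ hu.1, h.descends hu.2⟩
      exact Relation.ReflTransGen.head (b := (⟨w, hw⟩ : BallotPath m n)) h (ih hw)

/-! ## Words below a given one -/

/-- A boundary cutting `c ++ [false]` strictly inside would give `v` a prefix that descends to a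
negative level, because the proper nonempty prefixes of `c` have positive level. -/
theorem append_eq_of_rotation {m : ℕ} {u v a c b : List Bool} (hv : Above m 0 v)
    (hc : IsPrimitive m c) (e : u ++ v = a ++ (c ++ false :: b)) :
    (∃ b', u = a ++ (c ++ false :: b') ∧ b = b' ++ v) ∨
      ∃ a', a = u ++ a' ∧ v = a' ++ (c ++ false :: b) := by
  rcases List.append_eq_append_iff.1 e with ⟨a', h, h'⟩ | ⟨c', rfl, h⟩
  · exact Or.inr ⟨a', h, h'⟩
  rcases List.append_eq_append_iff.1 h with ⟨d, rfl, h'⟩ | ⟨d, rfl, rfl⟩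
  · cases d with
    | nil =>
      simp only [List.nil_append] at h'
      subst h'
      have := (above_false.1 hv).2.nonpos
      omega
    | cons x d =>
      simp only [List.cons_append, List.cons.injEq] at h'
      obtain ⟨rfl, rfl⟩ := h'
      exact Or.inl ⟨d, by simp, rfl⟩
  · by_cases hc' : c' = []
    · subst hc'
      exact Or.inr ⟨[], by simp, by simp⟩
    · rw [above_append, above_false] at hv
      have h1 := hc.descends.1
      have h2 := hv.1.le_lev
      rw [lev_append] at h1
      by_cases hd : d = []
      · subst hd
        have := hv.2.2.nonpos
        simp at this
      · have := hc.lev_pos hc' hd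
        omega

theorem wordLe_append_iff {m : ℕ} {k : ℤ} {u v w : List Bool} (hv : Descends m 0 v) :
    WordLe m w (u ++ v) ∧ Descends m k w ↔
      ∃ u' v', w = u' ++ v' ∧ (WordLe m u' u ∧ Descends m k u') ∧
        WordLe m v' v ∧ Descends m 0 v' := by
  constructor
  · rintro ⟨h, hw⟩
    -- The chain is followed downwards from the top word: the upper word is already decomposed, and
    -- one rotation is undone.
    induction h using Relation.ReflTransGen.head_induction_on with
    | refl => exact ⟨u, v, rfl, ⟨.refl, hw.of_append_right hv⟩, .refl, hv⟩
    | @head w w' hr _ ih =>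
      obtain ⟨u', v', rfl, ⟨hu', du⟩, hv', dv⟩ := ih (hr.descends hw)
      obtain ⟨a, c, b, hc, rfl, e⟩ := hr
      rcases append_eq_of_rotation dv.2 hc e with ⟨b', rfl, rfl⟩ | ⟨a', rfl, rfl⟩
      · have e' : a ++ false :: (c ++ (b' ++ v')) = (a ++ false :: (c ++ b')) ++ v' := by simp
        rw [e'] at hw ⊢
        exact ⟨_, _, rfl, ⟨.head ⟨a, c, b', hc, rfl, rfl⟩ hu', hw.of_append_right dv⟩, hv', dv⟩
      · have hr : WordRot m (a' ++ false :: (c ++ b)) (a' ++ (c ++ false :: b)) :=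
          ⟨a', c, b, hc, rfl, rfl⟩
        rw [List.append_assoc] at hw ⊢
        refine ⟨_, _, rfl, ⟨hu', du⟩, .head hr hv', hr.lev_eq.trans dv.1, ?_⟩
        have := (above_append.1 hw.2).2
        rwa [du.1, sub_self] at this
  · rintro ⟨u', v', rfl, ⟨h1, h2⟩, h3, h4⟩
    exact ⟨h1.append h3, h2.append h4⟩

theorem wordLe_true_iff {m : ℕ} {u w : List Bool} :
    WordLe m w (true :: u) ∧ Descends m 0 w ↔
      ∃ u', w = true :: u' ∧ WordLe m u' u ∧ Descends m (-m) u' := by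
  constructor
  · rintro ⟨h, hw⟩
    induction h using Relation.ReflTransGen.head_induction_on with
    | refl => exact ⟨u, rfl, .refl, descends_true.1 hw⟩
    | @head w w' hr _ ih =>
      obtain ⟨u', rfl, hu', du⟩ := ih (hr.descends hw)
      obtain ⟨a, c, b, hc, rfl, e⟩ := hr
      cases a with
      | nil =>
        have := (above_false.1 hw.2).2.nonpos
        omega
      | cons x a =>
        simp only [List.cons_append, List.cons.injEq] at e
        obtain ⟨rfl, rfl⟩ := e
        exact ⟨_, rfl, .head ⟨a, c, b, hc, rfl, rfl⟩ hu', descends_true.1 hw⟩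
  · rintro ⟨u', rfl, h, hd⟩
    exact ⟨h.append_left [true], descends_true.2 hd⟩

/-- A nonempty ballot word ends with a primitive word. -/
theorem Descends.exists_primitive {m : ℕ} {w : List Bool} (h : Descends m 0 w) (hw : w ≠ []) :
    ∃ u c, w = u ++ c ∧ Descends m 0 u ∧ IsPrimitive m c := by
  classical
  let P : ℕ → Prop := fun k => k < w.length ∧ lev m (w.take k) = 0
  have hP0 : P 0 := ⟨List.length_pos_iff.2 hw, by simp⟩
  -- `k` is the last contact with level 0 strictly before the end.
  set k := Nat.findGreatest P w.length with hk
  have hPk : P k := Nat.findGreatest_spec (Nat.zero_le _) hP0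
  have e := List.take_append_drop k w
  have hl : lev m (w.drop k) = 0 := by
    have := h.1
    rw [← e, lev_append, hPk.2] at this
    omega
  have ha := h.2
  rw [← e, above_append, hPk.2, sub_zero] at ha
  refine ⟨w.take k, w.drop k, e.symm, ⟨hPk.2, ha.1⟩, ⟨_, isBallot_iff.2 ⟨rfl, hl, ha.2⟩⟩, ?_, ?_⟩
  · intro h0
    have := hPk.1
    rw [List.drop_eq_nil_iff] at h0
    omega
  · intro p hp hne hne' hcount
    have hlt : p.length < (w.drop k).length := by
      refine lt_of_le_of_ne hp.length_le fun h => hne' (hp.eq_of_length h)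
    rw [List.length_drop] at hlt
    have hpos := List.length_pos_iff.2 hne
    have hp' : w.take (k + p.length) = w.take k ++ p := by
      rw [List.take_add, List.prefix_iff_eq_take.1 hp]
      simp
    have : P (k + p.length) := by
      refine ⟨by omega, ?_⟩
      rw [hp', lev_append, hPk.2, lev]
      zify at hcount; omega
    have := Nat.le_findGreatest this.1.le this
    omega

/-- The down step jumps over the primitive factors of `w` one at a time. -/
theorem wordLe_false_append {m : ℕ} {w : List Bool} (h : Descends m 0 w) :
    WordLe m (false :: w) (w ++ [false]) := by
  by_cases hw : w = []
  · subst hw; exact .refl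
  · obtain ⟨u, c, rfl, hu, hc⟩ := h.exists_primitive hw
    have hlt : u.length < (u ++ c).length := by
      have := List.length_pos_iff.2 hc.2.1
      simp; omega
    have h1 := (wordLe_false_append hu).append_right c
    exact h1.tail ⟨u, c, [], hc, by simp, by simp⟩
termination_by w.length

/-- The final down step is tracked through the undone rotations. A rotation either acts within `s`
or within `v`, or it moves the marked step itself back over a primitive word, which leaves `s ++ v`
unchanged. Conversely, `s0v ≤ sv0 ≤ u0`. -/
theorem wordLe_append_false_iff {m : ℕ} {k : ℤ} {u w : List Bool} (hu : Descends m k u) :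
    WordLe m w (u ++ [false]) ∧ Descends m (k - 1) w ↔
      ∃ s v, w = s ++ false :: v ∧ (WordLe m (s ++ v) u ∧ Descends m k (s ++ v)) ∧
        Descends m 0 v := by
  constructor
  · rintro ⟨h, hw⟩
    induction h using Relation.ReflTransGen.head_induction_on with
    | refl => exact ⟨u, [], rfl, by simpa using ⟨.refl, hu⟩, descends_nil⟩
    | @head w w' hr _ ih =>
      obtain ⟨s, v, rfl, ⟨hle, hd⟩, hv⟩ := ih (hr.descends hw)
      have hs := hd.of_append_right hv
      obtain ⟨a, c, b, hc, rfl, e⟩ := hr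
      rcases List.append_eq_append_iff.1 e with ⟨a', rfl, h⟩ | ⟨c', rfl, h⟩
      · cases a' with
        | nil =>
          cases c with
          | nil => exact absurd rfl hc.2.1
          | cons x c =>
            simp only [List.nil_append, List.cons_append, List.cons.injEq] at h
            obtain ⟨rfl, -⟩ := h
            exact hc.head_ne_false.elim
        | cons x a' =>
          simp only [List.cons_append, List.cons.injEq] at h
          obtain ⟨rfl, rfl⟩ := h
          have hr : WordRot m (a' ++ false :: (c ++ b)) (a' ++ (c ++ false :: b)) :=
            ⟨a', c, b, hc, rfl, rfl⟩
          have hd' : Descends m 0 (a' ++ false :: (c ++ b)) := by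
            refine ⟨hr.lev_eq.trans hv.1, ?_⟩
            have := hw.2
            rw [List.append_assoc, above_append, List.cons_append, above_false, hs.1] at this
            exact this.2.2.mono (by omega)
          exact ⟨s, _, by simp, ⟨.head (hr.append_left s) hle, hs.append hd'⟩, hd'⟩
      · rcases List.append_eq_append_iff.1 h with ⟨d, rfl, h'⟩ | ⟨d, rfl, h'⟩
        · cases d with
          | nil =>
            -- The marked down step is the one that moves: `c` passes from `s` to `v`.
            simp only [List.nil_append, List.cons.injEq, true_and] at h'
            subst h'
            refine ⟨a, c ++ b, rfl, ⟨by simpa using hle, by simpa using hd⟩, ?_⟩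
            exact hc.descends.append hv
          | cons x d =>
            simp only [List.cons_append, List.cons.injEq] at h'
            obtain ⟨rfl, rfl⟩ := h'
            have hr : WordRot m (a ++ false :: (c ++ d)) (a ++ (c ++ false :: d)) :=
              ⟨a, c, d, hc, rfl, rfl⟩
            have hd' : Descends m k (a ++ false :: (c ++ d)) := by
              refine ⟨hr.lev_eq.trans hs.1, ?_⟩
              have h1 := hs.2
              have h2 := hc.descends
              simp only [above_append, above_false, h2.1] at h1 ⊢
              obtain ⟨h3, h4, h5, h6⟩ := h1
              have := h6.nonpos
              exact ⟨h3, by omega, h2.2.mono (by omega), h6.mono (by omega)⟩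
            exact ⟨_, v, by simp, ⟨.head (hr.append_right v) hle, hd'.append hv⟩, hv⟩
        · cases d with
          | nil =>
            simp only [List.nil_append, List.cons.injEq, true_and] at h'
            subst h'
            refine ⟨a, c' ++ v, by simp, ⟨by simpa using hle, by simpa using hd⟩, ?_⟩
            have := hc.descends.append hv
            simpa using this
          -- A marked step inside `c` is impossible: `c'` would have level at least 1 and `a` level
          -- at least `k`, while `a ++ c'` ends at `k`.
          | cons x d =>
            simp only [List.cons_append, List.cons.injEq] at h'
            obtain ⟨rfl, -⟩ := h'
            have h1 := (above_append.1 hc.descends.2).2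
            have h2 := (above_false.1 h1).2.nonpos
            have h3 := (above_append.1 hs.2).1.le_lev
            have h4 := hs.1
            rw [lev_append] at h4
            omega
  · rintro ⟨s, v, rfl, ⟨hle, hd⟩, hv⟩
    have hs := hd.of_append_right hv
    refine ⟨?_, ?_⟩
    · have h1 := (wordLe_false_append hv).append_left s
      rw [← List.append_assoc] at h1
      exact h1.trans (hle.append_right [false])
    · have := hs.append_false.append hv
      simpa using this

/-! ## Counting ballot suffixes -/

open Classical in
/-- The number of nonempty suffixes of `w` which are ballot words. -/
noncomputable def suffixCount (m : ℕ) : List Bool → ℕ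
  | [] => 0
  | a :: w => suffixCount m w + if Descends m 0 (a :: w) then 1 else 0

theorem suffixCount_append {m : ℕ} {u v : List Bool} (hv : Descends m 0 v) :
    suffixCount m (u ++ v) = suffixCount m u + suffixCount m v := by
  classical
  induction u with
  | nil => simp [suffixCount]
  | cons a u ih =>
    have : Descends m 0 (a :: u ++ v) ↔ Descends m 0 (a :: u) :=
      ⟨fun h => h.of_append_right hv, fun h => h.append hv⟩
    simp only [List.cons_append, suffixCount] at this ⊢
    rw [ih, if_congr this rfl rfl]
    ring

theorem suffixCount_true {m : ℕ} {u : List Bool} (hu : Descends m (-m) u) :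
    suffixCount m (true :: u) = suffixCount m u + 1 := by
  simp [suffixCount, descends_true.2 hu]

/-- Every suffix of `s` has level at most 0, as `s` ends at its minimum; the down step then makes
the level of any suffix starting at or before it negative. -/
theorem suffixCount_append_false {m : ℕ} {k : ℤ} {s v : List Bool} (hs : Descends m k s)
    (hv : Descends m 0 v) : suffixCount m (s ++ false :: v) = suffixCount m v := by
  -- A suffix of `s` need not end at its own height `k`, so the induction remembers the removed
  -- prefix `r`.
  suffices H : ∀ r s : List Bool, lev m (r ++ s) = k → Above m k (r ++ s) →
      suffixCount m (s ++ false :: v) = suffixCount m v from H [] s hs.1 hs.2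
  intro r s
  induction s generalizing r with
  | nil =>
    intro _ _
    have : ¬ Descends m 0 (false :: v) := fun h => by
      have := (above_false.1 h.2).2.nonpos
      omega
    simp [suffixCount, this]
  | cons a s ih =>
    intro h1 h2
    have h3 := ih (r ++ [a]) (by simpa using h1) (by simpa using h2)
    have : ¬ Descends m 0 (a :: (s ++ false :: v)) := fun h => by
      have h4 := h.1
      have h5 := (above_append.1 h2).1.le_lev
      rw [← List.cons_append, lev_append, lev_false, hv.1] at h4
      rw [lev_append] at h1
      omega
    simp [suffixCount, this, h3]

open Classical in
theorem suffixCount_eq_card (m : ℕ) (w : List Bool) :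
    suffixCount m w = ((Finset.range w.length).filter fun k => Descends m 0 (w.drop k)).card := by
  rw [Finset.card_filter]
  induction w with
  | nil => simp [suffixCount]
  | cons a w ih =>
    rw [List.length_cons, Finset.sum_range_succ', suffixCount, ih]
    simp

open Classical in
/-- The ballot suffixes of `w` have `0, 1, …, suffixCount m w` nonempty ballot suffixes. -/
theorem sum_suffixes (m : ℕ) (w : List Bool) :
    ∑ k ∈ Finset.range (w.length + 1) with Descends m 0 (w.drop k),
        (X : ℤ[X]) ^ suffixCount m (w.drop k) =
      ∑ i ∈ Finset.range (suffixCount m w + 1), X ^ i := by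
  rw [Finset.sum_filter]
  induction w with
  | nil => simp [suffixCount, descends_nil]
  | cons a w ih =>
    rw [List.length_cons, Finset.sum_range_succ']
    simp only [List.drop_succ_cons, List.drop_zero, ih]
    by_cases h : Descends m 0 (a :: w)
    · simp only [suffixCount, h, if_true]
      rw [Finset.sum_range_succ _ (suffixCount m w + 1)]
    · simp [suffixCount, h]

theorem returns_eq_suffixCount {m n : ℕ} (D : BallotPath m n) :
    D.returns = suffixCount m D.1 := by
  classical
  obtain ⟨w, hw⟩ := D
  have hd := (isBallot_iff.1 hw).2
  have hiff (k : ℕ) : Descends m 0 (w.drop k) ↔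
      (w.take k).count false = m * (w.take k).count true := by
    have e := List.take_append_drop k w
    have h1 := hd.1
    have h2 := hd.2
    rw [← e, lev_append] at h1
    rw [← e, above_append] at h2
    have h3 : lev m (w.take k) = 0 ↔ (w.take k).count false = m * (w.take k).count true := by
      rw [lev]; zify; omega
    rw [← h3]
    refine ⟨fun h => by have := h.1; omega, fun h => ⟨by omega, ?_⟩⟩
    simpa [h] using h2.2
  rw [suffixCount_eq_card]
  unfold BallotPath.returns
  simp only [hiff, Finset.card_filter]
  -- Both ends are contacts, so counting over `1, …, length` or over `0, …, length - 1` gives the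
  -- same number.
  have h0 := Finset.sum_range_succ (fun k =>
    if (w.take k).count false = m * (w.take k).count true then 1 else 0) w.length
  rw [Finset.sum_range_succ'] at h0
  have h1 : w.count false = m * w.count true := by rw [hw.1]; exact hw.2.1
  simp only [List.take_zero, List.take_length, h1, List.count_nil, mul_zero, if_true,
    add_left_inj] at h0
  rw [← h0, Finset.range_eq_Ico, Finset.sum_Ico_add' (fun k =>
    if (w.take k).count false = m * (w.take k).count true then 1 else 0)]
  rfl

/-! ## The generating polynomials of lower sets -/

theorem finite_lower (m : ℕ) (k : ℤ) (u : List Bool) :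
    {w | WordLe m w u ∧ Descends m k w}.Finite :=
  (List.finite_length_eq Bool u.length).subset fun _ hw => hw.1.perm.length_eq

/-- The words below `u` which end at their lowest level `k`. -/
noncomputable def lower (m : ℕ) (k : ℤ) (u : List Bool) : Finset (List Bool) :=
  (finite_lower m k u).toFinset

theorem mem_lower {m : ℕ} {k : ℤ} {u w : List Bool} :
    w ∈ lower m k u ↔ WordLe m w u ∧ Descends m k w := by
  simp [lower]

/-- The words below `u`, counted according to the number of their nonempty ballot suffixes. -/
noncomputable def lowerPoly (m : ℕ) (k : ℤ) (u : List Bool) : ℤ[X] :=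
  ∑ w ∈ lower m k u, X ^ suffixCount m w

theorem lowerPoly_nil (m : ℕ) : lowerPoly m 0 [] = 1 := by
  have : lower m 0 [] = {[]} := by
    ext w
    rw [mem_lower, Finset.mem_singleton]
    refine ⟨fun h => by simpa using h.1.perm, ?_⟩
    rintro rfl
    exact ⟨.refl, descends_nil⟩
  simp [lowerPoly, this, suffixCount]

theorem lowerPoly_append {m : ℕ} {k : ℤ} {u v : List Bool} (hv : Descends m 0 v) :
    lowerPoly m k (u ++ v) = lowerPoly m k u * lowerPoly m 0 v := by
  classical
  have : lower m k (u ++ v) =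
      (lower m k u ×ˢ lower m 0 v).image fun p => p.1 ++ p.2 := by
    ext w
    simp only [mem_lower, wordLe_append_iff hv, Finset.mem_image, Finset.mem_product, Prod.exists]
    exact exists_congr fun a => exists_congr fun b => by tauto
  rw [lowerPoly, this, Finset.sum_image, lowerPoly, lowerPoly, Finset.sum_mul_sum,
    Finset.sum_product]
  · refine Finset.sum_congr rfl fun a _ => Finset.sum_congr rfl fun b hb => ?_
    rw [suffixCount_append (mem_lower.1 hb).2, pow_add]
  · rintro ⟨a, b⟩ h ⟨a', b'⟩ h' e
    simp only [Finset.coe_product, Set.mem_prod, Finset.mem_coe, mem_lower] at h h' e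
    -- Rotations preserve length, so the cut point is determined.
    have := List.append_inj e (h.1.1.perm.length_eq.trans h'.1.1.perm.length_eq.symm)
    exact Prod.ext this.1 this.2

theorem lowerPoly_true {m : ℕ} {u : List Bool} :
    lowerPoly m 0 (true :: u) = X * lowerPoly m (-m) u := by
  classical
  have : lower m 0 (true :: u) = (lower m (-m) u).image (true :: ·) := by
    ext w
    simp only [mem_lower, wordLe_true_iff, Finset.mem_image]
    exact exists_congr fun a => by tauto
  rw [lowerPoly, this, Finset.sum_image (by simp), lowerPoly, Finset.mul_sum]
  refine Finset.sum_congr rfl fun a ha => ?_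
  rw [suffixCount_true (mem_lower.1 ha).2, pow_succ']

/-- The displayed down step is where the word first drops below level `k`, so its position can be
recovered. -/
theorem append_false_injective {m : ℕ} {k : ℤ} {s s' v v' : List Bool} (hs : Descends m k s)
    (hs' : Descends m k s') (e : s ++ false :: v = s' ++ false :: v') : s = s' := by
  have key : ∀ {s s' v v' : List Bool}, Descends m k s → Descends m k s' →
      s ++ false :: v = s' ++ false :: v' → s' <+: s := by
    intro s s' v v' hs hs' e
    rcases List.append_eq_append_iff.1 e with ⟨a, rfl, h⟩ | ⟨a, rfl, -⟩
    · cases a with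
      | nil => simp
      | cons x a =>
        simp only [List.cons_append, List.cons.injEq] at h
        obtain ⟨rfl, -⟩ := h
        have := hs'.2
        rw [above_append, above_false, hs.1] at this
        have := this.2.2.nonpos
        omega
    · exact List.prefix_append _ _
  have h1 := key hs hs' e
  have h2 := key hs' hs e.symm
  exact h2.eq_of_length_le h1.length_le

theorem lowerPoly_append_false {m : ℕ} {k : ℤ} {u : List Bool} (hu : Descends m k u) :
    lowerPoly m (k - 1) (u ++ [false]) =
      ∑ w ∈ lower m k u, ∑ i ∈ Finset.range (suffixCount m w + 1), X ^ i := by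
  classical
  simp only [← sum_suffixes]
  rw [Finset.sum_sigma', lowerPoly]
  symm
  -- A pair is a word below `u` with the starting position of one of its ballot suffixes; the down
  -- step is inserted there.
  refine Finset.sum_bij (fun p _ => p.1.take p.2 ++ false :: p.1.drop p.2) ?_ ?_ ?_ ?_
  · rintro ⟨w, i⟩ h
    simp only [Finset.mem_sigma, mem_lower, Finset.mem_filter, Finset.mem_range] at h ⊢
    refine (wordLe_append_false_iff hu).2 ⟨w.take i, w.drop i, rfl, ?_, h.2.2⟩
    rw [List.take_append_drop]
    exact h.1
  · rintro ⟨w, i⟩ h ⟨w', i'⟩ h' e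
    simp only [Finset.mem_sigma, mem_lower, Finset.mem_filter, Finset.mem_range] at h h' e
    have hd {w : List Bool} {i : ℕ} (h1 : Descends m k w) (h2 : Descends m 0 (w.drop i)) :
        Descends m k (w.take i) := by
      rw [← List.take_append_drop i w] at h1
      exact h1.of_append_right h2
    have h1 := append_false_injective (hd h.1.2 h.2.2) (hd h'.1.2 h'.2.2) e
    rw [h1, List.append_cancel_left_eq, List.cons.injEq] at e
    have hw : w = w' := by
      rw [← List.take_append_drop i w, ← List.take_append_drop i' w', h1, e.2]
    have hi : i = i' := by
      have := congrArg List.length h1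
      rw [List.length_take, List.length_take] at this
      omega
    rw [hw, hi]
  · intro w hw
    obtain ⟨s, v, rfl, h, hv⟩ := (wordLe_append_false_iff hu).1 (mem_lower.1 hw)
    refine ⟨⟨s ++ v, s.length⟩, ?_, by simp⟩
    simp only [Finset.mem_sigma, mem_lower, Finset.mem_filter, Finset.mem_range]
    exact ⟨h, by simp, by simpa using hv⟩
  · rintro ⟨w, i⟩ h
    simp only [Finset.mem_sigma, mem_lower, Finset.mem_filter, Finset.mem_range] at h ⊢
    have h1 := h.1.2
    rw [← List.take_append_drop i w] at h1
    rw [suffixCount_append_false (h1.of_append_right h.2.2) h.2.2]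

/-- Multiplying by `X - 1` sums each geometric series to `X ^ (r + 1) - 1`; this is the defining
identity of `Δ`, free of division. -/
theorem lowerPoly_append_false_spec {m : ℕ} {k : ℤ} {u : List Bool} (hu : Descends m k u) :
    (X - 1) * lowerPoly m (k - 1) (u ++ [false]) =
      X * lowerPoly m k u - C ((lowerPoly m k u).eval 1) := by
  rw [lowerPoly_append_false hu, lowerPoly, Finset.mul_sum, Finset.mul_sum, eval_finsetSum]
  simp only [mul_geom_sum, Finset.sum_sub_distrib, pow_succ', eval_pow, eval_X, one_pow]
  simp

/-! ### The recursion at `y = 1` and the polynomials of trees -/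

theorem atYOne_Δ (g : ℤ[X][X]) :
    (X - 1) * atYOne (Δ g) = X * atYOne g - C ((atYOne g).eval 1) := by
  have h := congrArg atYOne (Δ_spec g)
  have e : atYOne (C (g.eval 1)) = C ((atYOne g).eval 1) := by
    simp only [atYOne, coe_mapRingHom, map_C, coe_evalRingHom]
    rw [eval_one_map]
    rfl
  rw [map_mul, map_sub, map_sub, map_mul, e] at h
  simpa [atYOne] using h

theorem atYOne_toXY (p : ℤ[X]) : atYOne (toXY p) = p := by
  simp only [atYOne, toXY, coe_mapRingHom, map_map]
  convert map_id (p := p)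
  ext
  simp

theorem Tree.word_descends {m : ℕ} (T : Tree m) : Descends m 0 T.word := by
  refine (isBallot_iff (n := T.size).1 ⟨T.word_count_true, ?_, T.word_balanced.2⟩).2
  rw [T.word_balanced.1, T.word_count_true]

/-- The word `D_{R_j} 0 … D_{R_1} 0` of a family of trees. -/
def chainWord {m j : ℕ} (g : Fin j → Tree m) : List Bool :=
  (List.ofFn fun i => (g i).word ++ [false]).reverse.flatten

theorem chainWord_succ {m j : ℕ} (g : Fin (j + 1) → Tree m) :
    chainWord g = chainWord (fun i => g i.succ) ++ (g 0).word ++ [false] := by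
  simp [chainWord, List.ofFn_succ]

theorem chainWord_descends {m j : ℕ} (g : Fin j → Tree m) :
    Descends m (-j) (chainWord g) := by
  induction j with
  | zero => simpa [chainWord] using descends_nil
  | succ j ih =>
    rw [chainWord_succ]
    have := ((ih fun i => g i.succ).append (g 0).word_descends).append_false
    convert this using 1
    push_cast; ring

theorem suffixCount_chainWord {m j : ℕ} (g : Fin j → Tree m) :
    suffixCount m (chainWord g) = 0 := by
  cases j with
  | zero => simp [chainWord, suffixCount]
  | succ j =>
    rw [chainWord_succ]
    exact suffixCount_append_false
      ((chainWord_descends fun i => g i.succ).append (g 0).word_descends) descends_nil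

/-- The outermost `Δ` belongs to `g 0`, whose word and down step come last in the chain. Both sides
satisfy the same identity after multiplication by `X - 1`, which can be cancelled. -/
theorem lowerPoly_chainWord {m j : ℕ} (g : Fin j → Tree m)
    (hg : ∀ i, (g i).poly = lowerPoly m 0 (g i).word) :
    atYOne ((List.ofFn fun i => toXY (g i).poly).foldr (fun h acc => Δ (h * acc)) 1) =
      lowerPoly m (-j) (chainWord g) := by
  induction j with
  | zero => simpa [chainWord] using (lowerPoly_nil m).symm
  | succ j ih =>
    have h1 := ih (fun i => g i.succ) fun i => hg _
    have h2 : (X - 1 : ℤ[X]) ≠ 0 := by simpa using X_sub_C_ne_zero (1 : ℤ)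
    refine mul_left_cancel₀ h2 ?_
    rw [List.ofFn_succ, List.foldr_cons, atYOne_Δ, map_mul, h1, atYOne_toXY, hg,
      chainWord_succ]
    have h3 := lowerPoly_append_false_spec
      ((chainWord_descends fun i => g i.succ).append (g 0).word_descends)
    rw [lowerPoly_append (g 0).word_descends, mul_comm (lowerPoly m _ (chainWord _))] at h3
    rw [← h3]
    congr 2
    push_cast; ring

theorem Tree.word_node_chainWord {m : ℕ} (f : Fin (m + 1) → Tree m) :
    (Tree.node f).word = (f 0).word ++ true :: chainWord fun i => f i.succ := rfl

theorem Tree.poly_eq_lowerPoly {m : ℕ} (T : Tree m) : T.poly = lowerPoly m 0 T.word := by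
  induction T with
  | empty => exact (lowerPoly_nil m).symm
  | node f ih =>
    have hd := descends_true.2 (chainWord_descends fun i => f i.succ)
    rw [Tree.word_node_chainWord, lowerPoly_append hd, lowerPoly_true, ← ih 0,
      ← lowerPoly_chainWord _ fun i => ih i.succ, Tree.poly, B]
    simp only [map_mul, atYOne_toXY]
    simp [atYOne]
    ring

/-- The chain of right subtrees has no nonempty ballot suffix, so each node of the left branch
contributes only the suffix starting at its up step. -/
theorem Tree.suffixCount_word {m : ℕ} (T : Tree m) : suffixCount m T.word = T.leftBranch := by
  induction T with
  | empty => rfl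
  | node f ih =>
    have hd := chainWord_descends fun i => f i.succ
    rw [Tree.word_node_chainWord, suffixCount_append (descends_true.2 hd), suffixCount_true hd,
      suffixCount_chainWord, ih, Tree.leftBranch]
    ring

/-! ## Every ballot path is the path of a tree -/

/-- A word is cut at the first point where it reaches its lowest level. -/
theorem Descends.exists_first {m : ℕ} {k : ℤ} {w : List Bool} (h : Descends m k w) :
    ∃ u v, w = u ++ v ∧ lev m u = k ∧ Descends m 0 v ∧
      ∀ p q, u = p ++ q → q ≠ [] → k < lev m p := by
  classical
  have hex : ∃ i, lev m (w.take i) = k := ⟨w.length, by simpa using h.1⟩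
  have e := List.take_append_drop (Nat.find hex) w
  have hi := Nat.find_spec hex
  have h1 := h.1
  have h2 := h.2
  rw [← e, lev_append, hi] at h1
  rw [← e, above_append, hi, sub_self] at h2
  refine ⟨_, _, e.symm, hi, ⟨by omega, h2.2⟩, fun p q hpq hq => ?_⟩
  have h3 := h2.1
  rw [hpq, above_append] at h3
  refine lt_of_le_of_ne h3.1.le_lev fun hk => ?_
  have hp : p = w.take p.length := by
    refine List.prefix_iff_eq_take.1 ?_
    exact ⟨q ++ w.drop (Nat.find hex), by rw [← List.append_assoc, ← hpq, e]⟩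
  have := Nat.find_min' hex (hp ▸ hk.symm : lev m (w.take p.length) = k)
  have hl := congrArg List.length hpq
  have := List.length_pos_iff.2 hq
  simp only [List.length_take, List.length_append] at hl
  omega

/-- A word reaching level `-(j + 1)` only at its end finishes with a down step. Cutting the rest at
its first visit to `-j` leaves a shorter chain followed by a ballot word, to which `H` applies. -/
theorem exists_chainWord {m j : ℕ} {u : List Bool} (hu : lev m u = -j)
    (hlt : ∀ p q, u = p ++ q → q ≠ [] → -(j : ℤ) < lev m p)
    (H : ∀ w : List Bool, w.length ≤ u.length → Descends m 0 w → ∃ T : Tree m, T.word = w) :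
    ∃ g : Fin j → Tree m, chainWord g = u := by
  induction j generalizing u with
  | zero =>
    refine ⟨Fin.elim0, ?_⟩
    by_contra hne
    have := hlt [] u rfl fun h => hne (by simp [chainWord, h])
    simp at this
  | succ j ih =>
    rcases List.eq_nil_or_concat u with rfl | ⟨v, a, rfl⟩
    · simp at hu; omega
    rw [List.concat_eq_append] at *
    have hv := hlt v [a] rfl (by simp)
    push_cast at hu hv hlt
    cases a with
    | true => simp at hu; omega
    | false =>
      have hv' : lev m v = -j := by simp at hu; omega
      have hd : Descends m (-j) v := by
        refine ⟨hv', fun p ⟨q, hq⟩ => ?_⟩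
        have := hlt p (q ++ [false]) (by simp [← hq]) (by simp)
        omega
      obtain ⟨s, t, rfl, hs, ht, hmin⟩ := hd.exists_first
      obtain ⟨g, rfl⟩ := ih hs hmin fun w hw => H w (hw.trans (by simp))
      obtain ⟨T, rfl⟩ := H t (by simp; omega) ht
      exact ⟨Fin.cons T g, by simp [chainWord_succ]⟩

theorem Descends.exists_tree {m : ℕ} {w : List Bool} (h : Descends m 0 w) :
    ∃ T : Tree m, T.word = w := by
  induction hn : w.length using Nat.strong_induction_on generalizing w with
  | _ n ih =>
    by_cases hw : w = []
    · exact ⟨.empty, hw.symm⟩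
    -- The last primitive factor carries the root and its right subtrees; what precedes it is the
    -- word of the left subtree.
    obtain ⟨u, c, rfl, hu, hc⟩ := h.exists_primitive hw
    cases c with
    | nil => exact absurd rfl hc.2.1
    | cons x c =>
      cases x with
      | false => exact hc.head_ne_false.elim
      | true =>
        simp at hn
        obtain ⟨T, rfl⟩ := ih u.length (by omega) hu rfl
        have hd := descends_true.1 hc.descends
        obtain ⟨g, rfl⟩ := exists_chainWord hd.1 (fun p q e hq => by
          have h1 : IsPrimitive m ((true :: p) ++ q) := by rw [List.cons_append, ← e]; exact hc
          have := h1.lev_pos (by simp) hq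
          rw [lev_true] at this
          omega) fun w hw hd => ih w.length (by omega) hd rfl
        exact ⟨.node (Fin.cons T g), by simp [Tree.word_node_chainWord]⟩

theorem SizedTree.toPath_surjective {m n : ℕ} :
    Function.Surjective (SizedTree.toPath (m := m) (n := n)) := by
  rintro ⟨w, hw⟩
  obtain ⟨T, rfl⟩ := (isBallot_iff.1 hw).2.exists_tree
  exact ⟨⟨T, T.word_count_true.symm.trans hw.1⟩, rfl⟩

/-! ### From words back to paths and trees -/

theorem SizedTree.returns_toPath {m n : ℕ} (T : SizedTree m n) :
    T.toPath.returns = T.1.leftBranch :=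
  (returns_eq_suffixCount _).trans T.1.suffixCount_word

theorem SizedTree.poly_eq_sum_paths {m n : ℕ} (T : SizedTree m n) :
    T.1.poly = ∑ D : BallotPath m n with D ≤ T.toPath, X ^ D.returns := by
  rw [Tree.poly_eq_lowerPoly, lowerPoly]
  symm
  refine Finset.sum_bij (fun D _ => D.1) ?_ (fun _ _ _ _ h => Subtype.ext h) ?_ ?_
  · intro D hD
    exact mem_lower.2 ⟨le_iff_wordLe.1 (Finset.mem_filter.1 hD).2, (isBallot_iff.1 D.2).2⟩
  · intro w hw
    rw [mem_lower] at hw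
    have hb : IsBallot m n w := isBallot_iff.2
      ⟨(hw.1.perm.count_eq true).trans (T.1.word_count_true.trans T.2), hw.2⟩
    exact ⟨⟨w, hb⟩, Finset.mem_filter.2 ⟨Finset.mem_univ _, le_iff_wordLe.2 hw.1⟩, rfl⟩
  · intro D _
    rw [returns_eq_suffixCount]

theorem SizedTree.poly_eq_sum_trees {m n : ℕ} (T : SizedTree m n) :
    T.1.poly = ∑ T' : SizedTree m n with T' ≤ T, X ^ T'.1.leftBranch := by
  rw [T.poly_eq_sum_paths]
  symm
  refine Finset.sum_bij (fun T' _ => T'.toPath) ?_ (fun _ _ _ _ h => toPath_injective h) ?_ ?_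
  · intro T' h
    exact Finset.mem_filter.2 ⟨Finset.mem_univ _, (Finset.mem_filter.1 h).2⟩
  · intro D hD
    obtain ⟨T', rfl⟩ := toPath_surjective D
    exact ⟨T', Finset.mem_filter.2 ⟨Finset.mem_univ _, (Finset.mem_filter.1 hD).2⟩, rfl⟩
  · intro T' _
    rw [returns_toPath]

end MTamari

theorem mainTheorem5 (m n : ℕ) (hm : 1 ≤ m) (T : MTamari.SizedTree m n) :
    (T.1.poly = ∑ T' : MTamari.SizedTree m n with T' ≤ T, Polynomial.X ^ T'.1.leftBranch) ∧
    (T.1.poly = ∑ D : MTamari.BallotPath m n with D ≤ T.toPath, Polynomial.X ^ D.returns) ∧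
    (∀ T' : MTamari.SizedTree m n, T'.toPath.returns = T'.1.leftBranch) ∧
    T.1.poly.eval 1 = ((Finset.univ.filter fun T' : MTamari.SizedTree m n => T' ≤ T).card : ℤ) ∧
    T.1.poly.eval 1 =
      ((Finset.univ.filter fun D : MTamari.BallotPath m n => D ≤ T.toPath).card : ℤ) := by
  refine ⟨T.poly_eq_sum_trees, T.poly_eq_sum_paths, MTamari.SizedTree.returns_toPath, ?_, ?_⟩
  · rw [T.poly_eq_sum_trees, eval_finsetSum]
    simp
  · rw [T.poly_eq_sum_paths, eval_finsetSum]
    simp
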